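/- Let $H$ be a graph with $h$ vertices and chromatic number $\chi(H)=r\ge 2$. For every $\alpha>0$ there exist $\mu,\beta_1,\gamma_1>0$ such that the following holds for all sufficiently large $n$. Let $G$ be a graph on $n$ vertices with minimum degree $\delta(G)\ge\left(1-\frac{1}{r-1}+\alpha\right)n$, and let $\mathcal F=\{F_v\}_{v\in V(G)}$ be a $\mu n$-bounded incompatibility system over $G$. Then for every vertex $u\in V(G)$ there are at least $\gamma_1 n$ vertices $v\ne u$ such that $u$ and $v$ are $(H,\beta_1 n,1)$-reachable. Here an incompatibility system over $G$ is a family $\{F_v\}_{v\in V(G)}$ in which each $F_v$ is a set of unordered pairs $\{e,e'\}$ of distinct edges of $G$ with $e\cap e'=\{v\}$. It is $\Delta$-bounded if for every vertex $v$ and every edge $e$ incident with $v$ there are at most $\Delta$ edges $e'$ with $\{e,e'\}\in F_v$. A subgraph of $G$ is compatible if no two of its edges form a pair belonging to $\bigcup_{v} F_v$. For $S\subseteq V(G)$, a compatible $H$-factor of the induced subgraph $G[S]$ is a collection of vertex-disjoint subgraphs of $G[S]$, each isomorphic to $H$, that together cover $S$ and whose union is compatible. For a real number $m\ge 0$ and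 $t\in\mathbb N$, two vertices $u,v$ are $(H,m,t)$-reachable if for every set $W\subseteq V(G)$ with $|W|\le m$ there is a set $S\subseteq V(G)\setminus W$ with $|S|\le ht-1$ such that both $G[S\cup\{u\}]$ and $G[S\cup\{v\}]$ have compatible $H$-factors. -/

import Mathlib

/-- An incompatibility system over a graph `G`: for every vertex `v` a family `F_v` of unordered
pairs `{e, e'}` of distinct edges of `G` such that `e ∩ e' = {v}`. -/
structure IncompatibilitySystem {V : Type*} (G : SimpleGraph V) where
  /-- The family `F_v`. -/
  pairs : V → Set (Sym2 (Sym2 V))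
  mem_pairs : ∀ (v : V) (e e' : Sym2 V), s(e, e') ∈ pairs v →
    e ∈ G.edgeSet ∧ e' ∈ G.edgeSet ∧ e ≠ e' ∧ ∀ x : V, (x ∈ e ∧ x ∈ e') ↔ x = v

namespace IncompatibilitySystem

/-- Two edges are incompatible if the pair they form lies in `F_v` for some vertex `v`. -/
def Incompatible {V : Type*} {G : SimpleGraph V} (F : IncompatibilitySystem G)
    (e e' : Sym2 V) : Prop :=
  ∃ v : V, s(e, e') ∈ F.pairs v

/-- A subgraph is compatible if no two of its edges are incompatible. -/
def IsCompatible {V : Type*} {G : SimpleGraph V} (F : IncompatibilitySystem G)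
    (T : G.Subgraph) : Prop :=
  ∀ e ∈ T.edgeSet, ∀ e' ∈ T.edgeSet, ¬ F.Incompatible e e'

/-- `F` is `Δ`-bounded if, for every vertex `v` and every edge `e` at `v`, at most `Δ` edges `e'`
form with `e` a pair in `F_v`. The bound is a real number, since it is used with `Δ = μ n`. -/
def IsBounded {V : Type*} [Fintype V] {G : SimpleGraph V} (F : IncompatibilitySystem G)
    (Δ : ℝ) : Prop :=
  ∀ v : V, ∀ e ∈ G.edgeSet, v ∈ e → ({e' : Sym2 V | s(e, e') ∈ F.pairs v}.ncard : ℝ) ≤ Δ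

/-- `(G, F)` is an `(n, δ, μ)`-incompatibility system: `G` has `n` vertices and minimum degree at
least `δ n`, and `F` is `μ n`-bounded. -/
structure IsSystem {V : Type*} [Fintype V] {G : SimpleGraph V} [DecidableRel G.Adj]
    (F : IncompatibilitySystem G) (n : ℕ) (δ μ : ℝ) : Prop where
  card_eq : Fintype.card V = n
  le_minDegree : δ * n ≤ (G.minDegree : ℝ)
  bounded : F.IsBounded (μ * n)

/-- The induced graph `G[S]` has a compatible `H`-factor: there is a collection `𝒯` of pairwise
vertex-disjoint copies of `H` in `G` (subgraphs isomorphic to `H`) whose vertex sets have union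
exactly `S`, and the union of these copies is compatible. -/
def HasCompatibleFactor {U V : Type*} {G : SimpleGraph V} (F : IncompatibilitySystem G)
    (H : SimpleGraph U) (S : Set V) : Prop :=
  ∃ 𝒯 : Set G.Subgraph,
    (∀ T ∈ 𝒯, Nonempty (H ≃g T.coe)) ∧
    (𝒯.Pairwise fun T T' => Disjoint T.verts T'.verts) ∧
    (⋃ T ∈ 𝒯, T.verts) = S ∧
    F.IsCompatible (sSup 𝒯)

/-- `S` is an `H`-connector for `u` and `v`: both `G[S ∪ {u}]` and `G[S ∪ {v}]` have compatible
`H`-factors. -/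
def IsConnector {U V : Type*} {G : SimpleGraph V} (F : IncompatibilitySystem G)
    (H : SimpleGraph U) (u v : V) (S : Set V) : Prop :=
  F.HasCompatibleFactor H (S ∪ {u}) ∧ F.HasCompatibleFactor H (S ∪ {v})

/-- `u` and `v` are `(H, m, t)`-reachable: for every set `W` of at most `m` vertices there is, outside
`W`, an `H`-connector for `u` and `v` with at most `h t - 1` vertices, where `h` is the number of
vertices of `H`. The number `m` is real, since the notion is used with `m = β n`. -/
def IsReachable {U V : Type*} [Fintype U] {G : SimpleGraph V} (F : IncompatibilitySystem G)
    (H : SimpleGraph U) (m : ℝ) (t : ℕ) (u v : V) : Prop :=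
  ∀ W : Finset V, (W.card : ℝ) ≤ m →
    ∃ S : Finset V, Disjoint S W ∧ S.card + 1 ≤ Fintype.card U * t ∧ F.IsConnector H u v (S : Set V)

end IncompatibilitySystem

open Finset

/-! Write r = k + 1. The degree condition gives any k vertices at least αn common neighbours. Hence
the neighbourhood of u contains at least (αn)^k ordered k-cliques x, each with (αn)^2 choices of a
pair (y, v) of common neighbours of x. By averaging, linearly many v have at least c n^(k+1) cliques
(y, x) with x inside N(u) ∩ N(v); these v, apart from u, are shown to be reachable.

For such v, supersaturation (`blowup_count`) gives a positive proportion of blow-ups with h slots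
per part all of whose transversals are such cliques. A proper (k+1)-colouring sends each vertex of H
to its own slot in the part of its colour. A vertex p of colour 0 may instead go to u or to v,
because its neighbours have other colours; the remaining images form S.

Resampling a single slot shows that each event spoiling injectivity, compatibility or avoidance of W
has density at most ε. With ε small against the density of blow-ups, some blow-up escapes them all
(`exists_connector`). -/

/-! ### Counting and supersaturation -/

theorem card_filter_equiv_prod {A B X : Type*} [Fintype A] [Fintype B] [Fintype X]
    (e : A × B ≃ X) (P : X → Prop) [DecidablePred P] :
    #{x | P x} = ∑ a, #{b | P (e (a, b))} := by
  simp only [Finset.card_filter]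
  rw [← Fintype.sum_equiv e (fun y => if P (e y) then 1 else 0) _ (fun _ => rfl),
    Fintype.sum_prod_type]

theorem card_filter_equiv_prod' {A B X : Type*} [Fintype A] [Fintype B] [Fintype X]
    (e : A × B ≃ X) (P : X → Prop) [DecidablePred P] :
    #{x | P x} = ∑ b, #{a | P (e (a, b))} := by
  simp only [Finset.card_filter]
  rw [← Fintype.sum_equiv e (fun y => if P (e y) then 1 else 0) _ (fun _ => rfl),
    Fintype.sum_prod_type_right]

theorem sum_card_filter_comm {A B : Type*} [Fintype A] [Fintype B] (P : A → B → Prop)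
    [∀ a, DecidablePred (P a)] [∀ b, DecidablePred fun a => P a b] :
    ∑ a, #{b | P a b} = ∑ b, #{a | P a b} := by
  simp only [Finset.card_filter]
  exact Finset.sum_comm

theorem pow_mul_card_le_sum_pow {ι : Type*} (s : Finset ι) (f : ι → ℝ) (hf : ∀ i ∈ s, 0 ≤ f i)
    (c : ℝ) (hc : 0 ≤ c) (h : c * #s ≤ ∑ i ∈ s, f i) (m : ℕ) :
    c ^ m * #s ≤ ∑ i ∈ s, f i ^ m := by
  rcases s.eq_empty_or_nonempty with rfl | hs
  · simp
  rcases m with _ | m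
  · simp
  have hpos : (0 : ℝ) < #s := by exact_mod_cast hs.card_pos
  refine le_trans ?_ (pow_sum_div_card_le_sum_pow hf m)
  rw [le_div_iff₀ (by positivity)]
  calc c ^ (m + 1) * #s * (#s : ℝ) ^ m = (c * #s) ^ (m + 1) := by ring
    _ ≤ _ := by gcongr

theorem card_filter_forall_pi {U V : Type*} [Fintype U] [DecidableEq U] [Fintype V]
    (P : V → Prop) [DecidablePred P]
    [DecidablePred fun ξ : U → V => ∀ s, P (ξ s)] :
    #{ξ : U → V | ∀ s, P (ξ s)} = #{a | P a} ^ Fintype.card U := by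
  have : ({ξ : U → V | ∀ s, P (ξ s)} : Finset _) = Fintype.piFinset fun _ : U => {a | P a} := by
    ext ξ; simp
  rw [this, Fintype.card_piFinset, Finset.prod_const, Finset.card_univ]

theorem forall_cons_iff {U V : Type*} {k : ℕ} (R : (Fin (k + 1) → V) → Prop) (ξ : U → V)
    (ψ : Fin k → U → V) :
    (∀ t : Fin k → U, ∀ s, R (Fin.cons (ξ s) fun i => ψ i (t i))) ↔
      ∀ t : Fin (k + 1) → U, R fun i => (Fin.cons ξ ψ : Fin (k + 1) → U → V) i (t i) := by
  have key : ∀ (s : U) (t : Fin k → U), (Fin.cons (ξ s) fun i => ψ i (t i) : Fin (k + 1) → V) =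
      fun i => (Fin.cons ξ ψ : Fin (k + 1) → U → V) i ((Fin.cons s t : Fin (k + 1) → U) i) := by
    intro s t
    funext i
    refine Fin.cases ?_ (fun i => ?_) i <;> simp only [Fin.cons_zero, Fin.cons_succ]
  constructor
  · intro H t
    have h1 := H (Fin.tail t) (t 0)
    rw [key, Fin.cons_self_tail] at h1
    exact h1
  · intro H t s
    rw [key]
    exact H _

-- Induction on the number of parts, with convexity used twice. Cloning the first coordinate m = |U|
-- times turns density c into c ^ m on average; cloning the others raises this to the power m ^ k.
open Classical in
theorem blowup_count {U V : Type*} [Fintype U] [Fintype V] [Nonempty V] (k : ℕ)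
    (R : (Fin k → V) → Prop) (c : ℝ) (hc : 0 ≤ c)
    (h : c * (Fintype.card V : ℝ) ^ k ≤ #{x | R x}) :
    c ^ (Fintype.card U ^ k) * (Fintype.card V : ℝ) ^ (k * Fintype.card U) ≤
      #{ψ : Fin k → U → V | ∀ t : Fin k → U, R fun i => ψ i (t i)} := by
  have hn : (0 : ℝ) < Fintype.card V := by exact_mod_cast Fintype.card_pos
  induction k generalizing c with
  | zero =>
    simp only [pow_zero, mul_one, pow_one, zero_mul] at h ⊢
    refine h.trans ?_
    norm_cast
    refine Finset.card_le_card_of_injOn (fun x i _ => x i) ?_ ?_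
    · intro x hx
      simp only [coe_filter, mem_univ, true_and, Set.mem_ofPred_eq] at hx ⊢
      exact fun _ => (Subsingleton.elim x _) ▸ hx
    · intro x _ y _ _
      exact Subsingleton.elim _ _
  | succ k ih =>
    set n : ℝ := (Fintype.card V : ℝ) with hn_def
    set m := Fintype.card U with hm
    obtain ⟨B, hB⟩ : ∃ B : (U → V) → (Fin k → V) → Prop,
        ∀ ξ y, B ξ y ↔ ∀ s, R (Fin.cons (ξ s) y) := ⟨_, fun _ _ => Iff.rfl⟩
    have h1 : (c * n) * #(univ : Finset (Fin k → V)) ≤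
        ∑ y : Fin k → V, (#{a | R (Fin.cons a y)} : ℝ) := by
      rw [card_filter_equiv_prod' (Fin.consEquiv fun _ => V)] at h
      push_cast at h
      rw [Finset.card_univ, Fintype.card_fun, Fintype.card_fin]
      push_cast
      rw [← hn_def]
      refine le_trans (le_of_eq (by ring)) h
    have h2 := pow_mul_card_le_sum_pow _ _ (fun _ _ => by positivity) _ (by positivity) h1 m
    -- For fixed y the m entries of ξ are chosen independently, so the admissible ξ number the m-th
    -- power of the degree of y.
    have h3 : ∑ y : Fin k → V, (#{a | R (Fin.cons a y)} : ℝ) ^ m =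
        ∑ ξ : U → V, (#{y | B ξ y} : ℝ) := by
      have := sum_card_filter_comm B
      have h4 : ∀ y : Fin k → V, #{ξ | B ξ y} = #{a | R (Fin.cons a y)} ^ m := fun y => by
        simp only [hB]
        exact card_filter_forall_pi fun a => R (Fin.cons a y)
      simp only [h4] at this
      exact_mod_cast this.symm
    have h5 : c ^ m * #(univ : Finset (U → V)) ≤
        ∑ ξ : U → V, (#{y | B ξ y} : ℝ) / n ^ k := by
      rw [h3] at h2
      rw [← Finset.sum_div, le_div_iff₀ (by positivity)]
      refine le_trans (le_of_eq ?_) h2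
      rw [Finset.card_univ, Fintype.card_fun, Finset.card_univ, Fintype.card_fun, Fintype.card_fin]
      push_cast
      rw [← hn_def, ← hm]
      ring
    have h6 := pow_mul_card_le_sum_pow _ _ (fun _ _ => by positivity) _ (by positivity) h5 (m ^ k)
    -- The induction hypothesis is applied with the exact density of `B ξ`, which varies with ξ.
    have h7 : ∀ ξ : U → V, ((#{y | B ξ y} : ℝ) / n ^ k) ^ (m ^ k) * n ^ (k * m) ≤
        #{ψ : Fin k → U → V | ∀ t : Fin k → U, B ξ fun i => ψ i (t i)} := by
      intro ξ
      refine ih (B ξ) _ (by positivity) (le_of_eq ?_)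
      field_simp
    rw [card_filter_equiv_prod (Fin.consEquiv fun _ => U → V)]
    push_cast
    calc c ^ (m ^ (k + 1)) * n ^ ((k + 1) * m)
        = ((c ^ m) ^ (m ^ k) * #(univ : Finset (U → V))) * n ^ (k * m) := by
          rw [Finset.card_univ, Fintype.card_fun]
          push_cast
          rw [← hn_def, ← hm]
          ring
      _ ≤ (∑ ξ : U → V, ((#{y | B ξ y} : ℝ) / n ^ k) ^ (m ^ k)) * n ^ (k * m) := by gcongr
      _ ≤ ∑ ξ : U → V,
          (#{ψ : Fin k → U → V | ∀ t : Fin k → U, B ξ fun i => ψ i (t i)} : ℝ) := by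
          rw [Finset.sum_mul]
          exact Finset.sum_le_sum fun ξ _ => h7 ξ
      _ = _ := by
          refine Finset.sum_congr rfl fun ξ _ => ?_
          congr 2
          ext ψ
          simp only [mem_filter, mem_univ, true_and]
          simp only [hB]
          exact forall_cons_iff R ξ ψ

/-- If every fibre of `P` in the direction of the coordinate `j` has density at most `ε`, then so
has `P`. -/
theorem card_filter_le_of_fibre {J V : Type*} [Fintype J] [DecidableEq J] [Fintype V] [Nonempty V]
    (j : J) (P : (J → V) → Prop) [DecidablePred P] (ε : ℝ)
    (h : ∀ ψ : J → V, (#{z | P (Function.update ψ j z)} : ℝ) ≤ ε * Fintype.card V) :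
    (#{ψ | P ψ} : ℝ) ≤ ε * (Fintype.card V : ℝ) ^ Fintype.card J := by
  classical
  have hn : (0 : ℝ) < Fintype.card V := by exact_mod_cast Fintype.card_pos
  -- Double counting: each tuple satisfying P arises from |V| pairs (ψ, z), since the old value at j
  -- is forgotten.
  have h1 : ∑ ψ : J → V, #{z | P (Function.update ψ j z)} = Fintype.card V * #{ψ | P ψ} := by
    rw [sum_card_filter_comm fun ψ z => P (Function.update ψ j z)]
    have h2 : ∀ z : V, #{ψ : J → V | P (Function.update ψ j z)} = Fintype.card V *
        #{g : {i // i ≠ j} → V | P ((Equiv.funSplitAt j V).symm (z, g))} := by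
      intro z
      rw [card_filter_equiv_prod (Equiv.funSplitAt j V).symm]
      rw [Finset.sum_congr rfl (g := fun _ =>
        #{g : {i // i ≠ j} → V | P ((Equiv.funSplitAt j V).symm (z, g))})]
      · simp
      · intro a _
        congr 2
        ext g
        refine iff_of_eq (congrArg P ?_)
        funext i
        by_cases hi : i = j
        · subst hi; simp [Equiv.funSplitAt, Equiv.piSplitAt]
        · simp [Equiv.funSplitAt, Equiv.piSplitAt, hi]
    simp only [h2]
    rw [← Finset.mul_sum, card_filter_equiv_prod (Equiv.funSplitAt j V).symm P]
  have h3 : (Fintype.card V : ℝ) * #{ψ | P ψ} ≤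
      Fintype.card V * (ε * (Fintype.card V : ℝ) ^ Fintype.card J) := by
    have : ((Fintype.card V * #{ψ | P ψ} : ℕ) : ℝ) ≤
        ∑ _ψ : J → V, ε * Fintype.card V := by
      rw [← h1]; push_cast
      exact Finset.sum_le_sum fun ψ _ => h ψ
    rw [Finset.sum_const, Finset.card_univ, Fintype.card_fun] at this
    push_cast [nsmul_eq_mul] at this
    refine this.trans (le_of_eq (by ring))
  exact le_of_mul_le_mul_left h3 hn

/-! ### Cliques shared by two vertices -/

/-- In a graph with few non-neighbours at each vertex, a small set has many common neighbours. -/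
theorem le_card_common_neighbors {V : Type*} [Fintype V] (G : SimpleGraph V) [DecidableRel G.Adj]
    (δ : ℝ) (hδ : δ ≤ G.minDegree) (T : Finset V) :
    (Fintype.card V : ℝ) - #T * (Fintype.card V - δ) ≤ #{w | ∀ t ∈ T, G.Adj t w} := by
  classical
  have h1 : ({w | ¬ ∀ t ∈ T, G.Adj t w} : Finset V) ⊆ T.biUnion fun t => {w | ¬ G.Adj t w} := by
    intro w; simp
  have h2 : ∀ t : V, (#{w | ¬ G.Adj t w} : ℝ) ≤ Fintype.card V - δ := by
    intro t
    have h3 := Finset.card_filter_add_card_filter_not (s := (univ : Finset V)) (fun w => G.Adj t w)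
    have h4 : #{w | G.Adj t w} = G.degree t := by
      rw [← G.card_neighborFinset_eq_degree]; congr 1; ext; simp
    have h5 : (G.minDegree : ℝ) ≤ G.degree t := by exact_mod_cast G.minDegree_le_degree t
    rw [h4, Finset.card_univ] at h3
    have h6 : (G.degree t : ℝ) + #{w | ¬ G.Adj t w} = Fintype.card V := by exact_mod_cast h3
    linarith
  have h7 : (#{w | ¬ ∀ t ∈ T, G.Adj t w} : ℝ) ≤ #T * (Fintype.card V - δ) := by
    calc (#{w | ¬ ∀ t ∈ T, G.Adj t w} : ℝ) ≤ ∑ t ∈ T, (#{w | ¬ G.Adj t w} : ℝ) := by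
          exact_mod_cast (Finset.card_le_card h1).trans Finset.card_biUnion_le
      _ ≤ ∑ _t ∈ T, ((Fintype.card V : ℝ) - δ) := Finset.sum_le_sum fun t _ => h2 t
      _ = _ := by rw [Finset.sum_const, nsmul_eq_mul]
  have h8 := Finset.card_filter_add_card_filter_not (s := (univ : Finset V))
    (fun w => ∀ t ∈ T, G.Adj t w)
  rw [Finset.card_univ] at h8
  have h9 : (#{w | ∀ t ∈ T, G.Adj t w} : ℝ) + #{w | ¬ ∀ t ∈ T, G.Adj t w} = Fintype.card V := by
    exact_mod_cast h8
  have h10 : (Fintype.card V : ℝ) - #T * (Fintype.card V - δ) ≤ #{w | ∀ t ∈ T, G.Adj t w} := by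
    linarith
  convert h10

/-- `x` is an ordered clique in the neighbourhood of `u`. -/
def IsLinkClique {V : Type*} (G : SimpleGraph V) (u : V) {k : ℕ} (x : Fin k → V) : Prop :=
  (∀ i, G.Adj u (x i)) ∧ ∀ i j, i ≠ j → G.Adj (x i) (x j)

open Classical in
theorem pow_le_card_linkClique {V : Type*} [Fintype V] (G : SimpleGraph V) (m : ℕ) (d : ℝ)
    (hd : 0 ≤ d) (h : ∀ T : Finset V, #T ≤ m → d ≤ #{w | ∀ t ∈ T, G.Adj t w}) (u : V) (k : ℕ)
    (hk : k ≤ m) : d ^ k ≤ #{x : Fin k → V | IsLinkClique G u x} := by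
  induction k with
  | zero => simp [IsLinkClique]
  | succ k ih =>
    rw [card_filter_equiv_prod' (Fin.consEquiv fun _ => V)]
    push_cast
    have key : ∀ x : Fin k → V, IsLinkClique G u x →
        d ≤ #{a | IsLinkClique G u (Fin.consEquiv (fun _ => V) (a, x))} := by
      intro x hx
      -- The vertex u takes one place, so extending k clique vertices involves k + 1 ≤ m vertices.
      have hT : #(insert u (univ.image x)) ≤ m := by
        refine (Finset.card_insert_le _ _).trans ?_
        have := Finset.card_image_le (s := (univ : Finset (Fin k))) (f := x)
        simp only [Finset.card_univ, Fintype.card_fin] at this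
        omega
      refine (h _ hT).trans ?_
      norm_cast
      refine Finset.card_le_card fun a => ?_
      simp only [mem_filter, mem_univ, true_and]
      intro ha
      have hu : G.Adj u a := ha u (by simp)
      have hx' : ∀ i, G.Adj (x i) a := fun i => ha (x i) (by simp)
      refine ⟨fun i => ?_, fun i j => ?_⟩
      · refine Fin.cases hu (fun i => ?_) i
        exact hx.1 i
      · refine Fin.cases ?_ (fun i => ?_) i <;> refine Fin.cases ?_ (fun j => ?_) j
        · intro h0; exact absurd rfl h0
        · intro _; exact (hx' j).symm
        · intro _; exact hx' i
        · intro hij; exact hx.2 i j fun h0 => hij (by rw [h0])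
    calc d ^ (k + 1) = d ^ k * d := pow_succ _ _
      _ ≤ #{x : Fin k → V | IsLinkClique G u x} * d := by
          gcongr; exact ih (by omega)
      _ = ∑ x : Fin k → V with IsLinkClique G u x, d := by simp
      _ ≤ ∑ x : Fin k → V with IsLinkClique G u x,
          (#{a | IsLinkClique G u (Fin.consEquiv (fun _ => V) (a, x))} : ℝ) :=
          Finset.sum_le_sum fun x hx => key x (by simpa using hx)
      _ ≤ _ := Finset.sum_le_sum_of_subset_of_nonneg (Finset.subset_univ _)
          fun _ _ _ => by positivity

/-- `y` is an ordered clique all of whose vertices, except possibly the first, are adjacent to both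
`u` and `v`. -/
def IsSharedClique {V : Type*} (G : SimpleGraph V) (u v : V) {k : ℕ} (y : Fin (k + 1) → V) : Prop :=
  (∀ i j, i ≠ j → G.Adj (y i) (y j)) ∧ ∀ i, i ≠ 0 → G.Adj u (y i) ∧ G.Adj v (y i)

-- Once a clique x in the link of u is chosen, v and y 0 are independent choices among the common
-- neighbours of x. Leaving y 0 free of u and v is what keeps the sets T at size k.
open Classical in
theorem pow_le_sum_card_sharedClique {V : Type*} [Fintype V] (G : SimpleGraph V) (k : ℕ) (d : ℝ)
    (hd : 0 ≤ d) (h : ∀ T : Finset V, #T ≤ k → d ≤ #{w | ∀ t ∈ T, G.Adj t w}) (u : V) :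
    d ^ (k + 2) ≤ ∑ v, (#{y : Fin (k + 1) → V | IsSharedClique G u v y} : ℝ) := by
  have h1 : ∑ v, (#{y : Fin (k + 1) → V | IsSharedClique G u v y} : ℝ) =
      ∑ x : Fin k → V, ∑ v, (#{a | IsSharedClique G u v (Fin.consEquiv (fun _ => V) (a, x))} : ℝ) := by
    rw [Finset.sum_comm]
    refine Finset.sum_congr rfl fun v _ => ?_
    rw [card_filter_equiv_prod' (Fin.consEquiv fun _ => V)]
    push_cast
    rfl
  rw [h1]
  have key : ∀ x : Fin k → V, IsLinkClique G u x → d * d ≤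
      ∑ v, (#{a | IsSharedClique G u v (Fin.consEquiv (fun _ => V) (a, x))} : ℝ) := by
    intro x hx
    set N : Finset V := {w | ∀ t ∈ univ.image x, G.Adj t w} with hN
    have hdN : d ≤ #N := by
      refine h _ ?_
      have := Finset.card_image_le (s := (univ : Finset (Fin k))) (f := x)
      simpa using this
    have hmem : ∀ w, w ∈ N ↔ ∀ i, G.Adj (x i) w := by intro w; simp [hN]
    have h2 : ∀ v ∈ N, (d : ℝ) ≤
        #{a | IsSharedClique G u v (Fin.consEquiv (fun _ => V) (a, x))} := by
      intro v hv
      refine hdN.trans ?_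
      norm_cast
      refine Finset.card_le_card fun a ha => ?_
      rw [hmem] at ha hv
      simp only [mem_filter, mem_univ, true_and]
      refine ⟨fun i j => ?_, fun i => ?_⟩
      · refine Fin.cases ?_ (fun i => ?_) i <;> refine Fin.cases ?_ (fun j => ?_) j
        · intro h0; exact absurd rfl h0
        · intro _; exact (ha j).symm
        · intro _; exact ha i
        · intro hij; exact hx.2 i j fun h0 => hij (by rw [h0])
      · refine Fin.cases ?_ (fun i => ?_) i
        · intro h0; exact absurd rfl h0
        · intro _; exact ⟨hx.1 i, (hv i).symm⟩
    calc d * d ≤ #N * d := by gcongr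
      _ = ∑ v ∈ N, d := by simp
      _ ≤ ∑ v ∈ N, (#{a | IsSharedClique G u v (Fin.consEquiv (fun _ => V) (a, x))} : ℝ) :=
          Finset.sum_le_sum h2
      _ ≤ _ := Finset.sum_le_sum_of_subset_of_nonneg (Finset.subset_univ _)
          fun _ _ _ => by positivity
  calc d ^ (k + 2) = d ^ k * (d * d) := by ring
    _ ≤ #{x : Fin k → V | IsLinkClique G u x} * (d * d) := by
        gcongr; exact pow_le_card_linkClique G k d hd h u k le_rfl
    _ = ∑ x : Fin k → V with IsLinkClique G u x, (d * d) := by simp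
    _ ≤ ∑ x : Fin k → V with IsLinkClique G u x,
        ∑ v, (#{a | IsSharedClique G u v (Fin.consEquiv (fun _ => V) (a, x))} : ℝ) :=
        Finset.sum_le_sum fun x hx => key x (by simpa using hx)
    _ ≤ _ := Finset.sum_le_sum_of_subset_of_nonneg (Finset.subset_univ _)
        fun _ _ _ => Finset.sum_nonneg fun _ _ => by positivity

/-- Reverse Markov: values below c M contribute at most half of the assumed lower bound, hence the
factor 2. -/
theorem le_card_filter_of_le_sum {V : Type*} [Fintype V] (f : V → ℝ) (M c : ℝ) (hM : 0 < M)
    (hf : ∀ v, f v ≤ M) (hc : 0 ≤ c) (h : 2 * c * (Fintype.card V * M) ≤ ∑ v, f v)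
    [DecidablePred fun v => c * M ≤ f v] :
    c * Fintype.card V ≤ #{v | c * M ≤ f v} := by
  have h1 : ∑ v, f v ≤ #{v | c * M ≤ f v} * M + Fintype.card V * (c * M) := by
    rw [← Finset.sum_filter_add_sum_filter_not univ fun v => c * M ≤ f v]
    refine add_le_add ?_ ?_
    · simpa using Finset.sum_le_card_nsmul _ f M fun v _ => hf v
    · refine (Finset.sum_le_card_nsmul _ f (c * M) fun v hv => ?_).trans ?_
      · simp only [mem_filter, not_le] at hv; exact hv.2.le
      · rw [nsmul_eq_mul]
        gcongr
        exact Finset.card_le_univ _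
  have : (c * Fintype.card V) * M ≤ #{v | c * M ≤ f v} * M := by linarith
  exact le_of_mul_le_mul_right this hM

/-! ### Compatible embeddings by resampling -/

namespace IncompatibilitySystem

variable {U V : Type*} {G : SimpleGraph V} (F : IncompatibilitySystem G)

theorem Incompatible.symm {F : IncompatibilitySystem G} {e e' : Sym2 V}
    (h : F.Incompatible e e') : F.Incompatible e' e := by
  obtain ⟨w, hw⟩ := h
  exact ⟨w, Sym2.eq_swap ▸ hw⟩

/-- Incompatible edges meet in a vertex, so injectivity puts them in the form φ a φ b, φ a φ c. The
compatibility hypothesis covers all such pairs, not only edges of H. -/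
theorem hasCompatibleFactor_range (H : SimpleGraph U) (φ : U → V) (hinj : Function.Injective φ)
    (hadj : ∀ a b, H.Adj a b → G.Adj (φ a) (φ b))
    (hcomp : ∀ a b c, a ≠ b → a ≠ c → b ≠ c →
      ¬ F.Incompatible s(φ a, φ b) s(φ a, φ c)) :
    F.HasCompatibleFactor H (Set.range φ) := by
  let f : SimpleGraph.Copy H G := ⟨⟨φ, fun {a b} h => hadj a b h⟩, hinj⟩
  refine ⟨{f.toSubgraph}, ?_, Set.pairwise_singleton _ _, ?_, ?_⟩
  · rintro T rfl
    exact ⟨f.isoToSubgraph⟩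
  · rw [Set.biUnion_singleton]
    ext x
    simp [f, SimpleGraph.Copy.toSubgraph]
  · rw [sSup_singleton]
    have hedge : ∀ e ∈ f.toSubgraph.edgeSet, ∃ a b, a ≠ b ∧ e = s(φ a, φ b) := by
      intro e
      induction e with
      | _ x y =>
        intro he
        obtain ⟨z, hz, hzxy⟩ : ∃ z ∈ H.edgeSet, Sym2.map (fun a => φ a) z = s(x, y) := by
          simpa [f, SimpleGraph.Copy.toSubgraph] using he
        induction z with
        | _ a b => exact ⟨a, b, SimpleGraph.Adj.ne hz, hzxy.symm⟩
    intro e he e' he' hinc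
    obtain ⟨a, b, hab, rfl⟩ := hedge e he
    obtain ⟨c, d, hcd, rfl⟩ := hedge e' he'
    obtain ⟨w, hw⟩ := hinc
    obtain ⟨-, -, hne, hmem⟩ := F.mem_pairs w _ _ hw
    have hinc : F.Incompatible s(φ a, φ b) s(φ c, φ d) := ⟨w, hw⟩
    obtain ⟨h1, h2⟩ := (hmem w).2 rfl
    rw [Sym2.mem_iff] at h1 h2
    have main : ∀ a b c d, a ≠ b → c ≠ d → φ a = φ c → s(φ a, φ b) ≠ s(φ c, φ d) →
        F.Incompatible s(φ a, φ b) s(φ c, φ d) → False := by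
      intro a b c d hab hcd hac hne hinc
      obtain rfl := hinj hac
      exact hcomp a b d hab hcd (fun h => hne (by rw [h])) hinc
    rcases h1 with h1 | h1 <;> rcases h2 with h2 | h2
    · exact main a b c d hab hcd (h1.symm.trans h2) hne hinc
    · rw [Sym2.eq_swap (a := φ c)] at hne hinc
      exact main a b d c hab hcd.symm (h1.symm.trans h2) hne hinc
    · rw [Sym2.eq_swap (a := φ a)] at hne hinc
      exact main b a c d hab.symm hcd (h1.symm.trans h2) hne hinc
    · rw [Sym2.eq_swap (a := φ a), Sym2.eq_swap (a := φ c)] at hne hinc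
      exact main b a d c hab.symm hcd.symm (h1.symm.trans h2) hne hinc

open Classical in
theorem card_incompatible_le [Fintype V] {Δ : ℝ} (hΔ : 0 ≤ Δ) (hF : F.IsBounded Δ) (x y : V) :
    (#{z | F.Incompatible s(x, y) s(x, z)} : ℝ) ≤ Δ := by
  by_cases hxy : s(x, y) ∈ G.edgeSet
  · refine le_trans ?_ (hF x s(x, y) hxy (Sym2.mem_mk_left x y))
    norm_cast
    rw [← Set.ncard_coe_finset]
    refine Set.ncard_le_ncard_of_injOn (fun z => s(x, z)) ?_ ?_ (Set.toFinite _)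
    · intro z hz
      simp only [coe_filter, mem_univ, true_and, Set.mem_ofPred_eq] at hz ⊢
      obtain ⟨w, hw⟩ := hz
      have hmem := (F.mem_pairs w _ _ hw).2.2.2 x
      rw [← hmem.1 ⟨Sym2.mem_mk_left x y, Sym2.mem_mk_left x z⟩] at hw
      exact hw
    · intro z _ z' _ h
      exact Sym2.congr_right.1 h
  · have : ({z | F.Incompatible s(x, y) s(x, z)} : Finset V) = ∅ := by
      ext z
      simp only [mem_filter, mem_univ, true_and, notMem_empty, iff_false]
      rintro ⟨w, hw⟩
      exact hxy (F.mem_pairs w _ _ hw).1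
    rw [this]
    simpa using hΔ

/-- The image of `s` under `φ` obstructs `φ` from being a compatible embedding that avoids `W`. -/
def IsObstructed (W : Finset V) (φ : U → V) (s : U) : Prop :=
  φ s ∈ W ∨ (∃ s', s' ≠ s ∧ φ s' = φ s) ∨
    ∃ q : U × U, q.1 ≠ s ∧ q.2 ≠ s ∧ F.Incompatible s(φ q.1, φ q.2) s(φ q.1, φ s)

-- Since q.1 and q.2 differ from s, the edge φ q.1 φ q.2 stays fixed while the image of s moves, so
-- boundedness excludes at most Δ values for each q.
open Classical in
theorem card_isObstructed_update_le [Fintype U] [Fintype V] {Δ : ℝ} (hΔ : 0 ≤ Δ)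
    (hF : F.IsBounded Δ) (W : Finset V) (φ : U → V) (s : U) :
    (#{z | F.IsObstructed W (Function.update φ s z) s} : ℝ) ≤
      #W + Fintype.card U + (Fintype.card U : ℝ) ^ 2 * Δ := by
  have hsub : ({z | F.IsObstructed W (Function.update φ s z) s} : Finset V) ⊆
      W ∪ univ.image φ ∪ (univ : Finset (U × U)).biUnion
        fun q => {z | F.Incompatible s(φ q.1, φ q.2) s(φ q.1, z)} := by
    intro z
    simp only [mem_filter, mem_univ, true_and, mem_union, mem_image, mem_biUnion]
    rintro (h | ⟨s', hs', h⟩ | ⟨q, h1, h2, h⟩)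
    · simp only [Function.update_self] at h
      exact Or.inl (Or.inl h)
    · rw [Function.update_self, Function.update_of_ne hs'] at h
      exact Or.inl (Or.inr ⟨s', h⟩)
    · rw [Function.update_self, Function.update_of_ne h1, Function.update_of_ne h2] at h
      exact Or.inr ⟨q, h⟩
  have h1 : (#(univ.image φ) : ℝ) ≤ Fintype.card U := by
    exact_mod_cast Finset.card_image_le
  have h2 : (#((univ : Finset (U × U)).biUnion
        fun q => {z | F.Incompatible s(φ q.1, φ q.2) s(φ q.1, z)}) : ℝ) ≤
      (Fintype.card U : ℝ) ^ 2 * Δ := by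
    calc _ ≤ ∑ q : U × U, (#{z | F.Incompatible s(φ q.1, φ q.2) s(φ q.1, z)} : ℝ) := by
          exact_mod_cast Finset.card_biUnion_le
      _ ≤ ∑ _q : U × U, Δ := Finset.sum_le_sum fun q _ => F.card_incompatible_le hΔ hF _ _
      _ = _ := by
          rw [Finset.sum_const, Finset.card_univ, Fintype.card_prod, nsmul_eq_mul]
          push_cast
          ring
  have h3 : (#{z | F.IsObstructed W (Function.update φ s z) s} : ℝ) ≤
      #W + #(univ.image φ) + #((univ : Finset (U × U)).biUnion
        fun q => {z | F.Incompatible s(φ q.1, φ q.2) s(φ q.1, z)}) := by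
    exact_mod_cast (Finset.card_le_card hsub).trans ((Finset.card_union_le _ _).trans
      (Nat.add_le_add_right (Finset.card_union_le _ _) _))
  linarith

/-- The vertex p need not be tested: of two colliding vertices, or of the two outer ends of a pair
of edges at a common vertex, at least one is not p and can play the role of s. -/
theorem hasCompatibleFactor_range_of_not_isObstructed (H : SimpleGraph U) (φ : U → V)
    (W : Finset V) (p : U) (hadj : ∀ a b, H.Adj a b → G.Adj (φ a) (φ b))
    (hφ : ∀ s, s ≠ p → ¬ F.IsObstructed W φ s) :
    Function.Injective φ ∧ F.HasCompatibleFactor H (Set.range φ) := by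
  have hinj : Function.Injective φ := by
    intro a b hab
    by_contra hne
    by_cases hb : b = p
    · exact hφ a (fun h => hne (h.trans hb.symm)) (Or.inr (Or.inl ⟨b, Ne.symm hne, hab.symm⟩))
    · exact hφ b hb (Or.inr (Or.inl ⟨a, hne, hab⟩))
  refine ⟨hinj, F.hasCompatibleFactor_range H φ hinj hadj ?_⟩
  intro a b c hab hac hbc hinc
  by_cases hc : c = p
  · exact hφ b (fun h => hbc (h.trans hc.symm))
      (Or.inr (Or.inr ⟨(a, c), hab, hbc.symm, hinc.symm⟩))
  · exact hφ c hc (Or.inr (Or.inr ⟨(a, b), hac, hbc, hinc⟩))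

open Classical in
/-- The map that sends `p` to `w` and every other vertex `s` to the `s`-th vertex of the part that
has the colour of `s`. -/
noncomputable def place {I : Type*} (C : U → I) (p : U) (w : V) (ψ : I × U → V) : U → V :=
  Function.update (fun s => ψ (C s, s)) p w

-- The slot (C s, s) is read by s alone, so resampling it moves one image only.
open Classical in
theorem place_update {I : Type*} [DecidableEq (I × U)] (C : U → I) (p : U) (w : V)
    (ψ : I × U → V) (s : U) (hs : s ≠ p)
    (z : V) :
    place C p w (Function.update ψ (C s, s) z) = Function.update (place C p w ψ) s z := by
  funext a
  unfold place
  by_cases hap : a = p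
  · subst hap
    rw [Function.update_self, Function.update_of_ne hs.symm, Function.update_self]
  · rw [Function.update_of_ne hap]
    by_cases has : a = s
    · subst has
      simp
    · rw [Function.update_of_ne has, Function.update_of_ne hap, Function.update_of_ne]
      simp [has]

theorem place_adj {H : SimpleGraph U} {k : ℕ} (C : H.Coloring (Fin (k + 1))) (p : U)
    (hp : C p = 0) (u v : V) (ψ : Fin (k + 1) × U → V)
    (hψ : ∀ t : Fin (k + 1) → U, IsSharedClique G u v fun i => ψ (i, t i)) (w : V)
    (hw : w = u ∨ w = v) (a b : U) (hab : H.Adj a b) :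
    G.Adj (place C p w ψ a) (place C p w ψ b) := by
  classical
  have hpw : ∀ b, b ≠ p → C b ≠ C p → G.Adj w (ψ (C b, b)) := by
    intro b hb hC
    have := (hψ fun _ => b).2 (C b) (hp ▸ hC)
    rcases hw with rfl | rfl
    · exact this.1
    · exact this.2
  unfold place
  have hC := C.valid hab
  by_cases ha : a = p
  · subst ha
    rw [Function.update_self, Function.update_of_ne hab.ne.symm]
    exact hpw b hab.ne.symm hC.symm
  · by_cases hb : b = p
    · subst hb
      rw [Function.update_self, Function.update_of_ne ha]
      exact (hpw a ha hC).symm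
    · rw [Function.update_of_ne ha, Function.update_of_ne hb]
      -- This transversal passes through the slots of both a and b.
      have := (hψ fun i => if i = C a then a else b).1 (C a) (C b) hC
      simpa [hC.symm] using this

open Classical in
theorem exists_connector [Fintype U] [Fintype V] [Nonempty V] {H : SimpleGraph U} {k : ℕ}
    (C : H.Coloring (Fin (k + 1))) (p : U) (hp : C p = 0) (u v : V) (W : Finset V) {Δ : ℝ}
    (hΔ : 0 ≤ Δ) (hF : F.IsBounded Δ) (κ ε : ℝ)
    (hε : #W + Fintype.card U + (Fintype.card U : ℝ) ^ 2 * Δ ≤ ε * Fintype.card V)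
    (hκ : 2 * Fintype.card U * ε < κ)
    (hcount : κ * (Fintype.card V : ℝ) ^ ((k + 1) * Fintype.card U) ≤
      #{ψ : Fin (k + 1) → U → V | ∀ t : Fin (k + 1) → U, IsSharedClique G u v fun i => ψ i (t i)}) :
    ∃ S : Finset V, Disjoint S W ∧ #S + 1 ≤ Fintype.card U ∧ F.IsConnector H u v (S : Set V) := by
  have hn : (0 : ℝ) < Fintype.card V := by exact_mod_cast Fintype.card_pos
  set N : ℝ := (Fintype.card V : ℝ) ^ ((k + 1) * Fintype.card U) with hN
  have hNpos : 0 < N := by positivity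
  let good : Finset (Fin (k + 1) × U → V) :=
    {ψ | ∀ t : Fin (k + 1) → U, IsSharedClique G u v fun i => ψ (i, t i)}
  let w : Bool → V := fun b => if b then u else v
  -- One event per vertex s ≠ p and per placement of p, at u or at v: this gives the factor 2|U| in
  -- `hκ`.
  let bad : Bool × {s : U // s ≠ p} → Finset (Fin (k + 1) × U → V) := fun q =>
    {ψ | F.IsObstructed W (place C p (w q.1) ψ) q.2}
  have hgood : κ * N ≤ #good := by
    refine hcount.trans ?_
    norm_cast
    refine Finset.card_le_card_of_injOn (fun ψ q => ψ q.1 q.2) ?_ ?_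
    · intro ψ hψ
      simpa [good] using hψ
    · intro ψ _ ψ' _ h
      funext i s
      exact congrFun h (i, s)
  have hε0 : 0 ≤ ε := by
    have : 0 ≤ ε * Fintype.card V := le_trans (by positivity) hε
    exact nonneg_of_mul_nonneg_left this hn
  have hbad : ∀ q, (#(bad q) : ℝ) ≤ ε * N := by
    intro q
    have := card_filter_le_of_fibre (C q.2, (q.2 : U))
      (fun ψ : Fin (k + 1) × U → V => F.IsObstructed W (place C p (w q.1) ψ) q.2) ε (fun ψ => by
        simp only [place_update C p (w q.1) ψ q.2 q.2.2]
        exact (F.card_isObstructed_update_le hΔ hF W _ _).trans hε)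
    rwa [Fintype.card_prod, Fintype.card_fin] at this
  have hlt : #(univ.biUnion bad) < #good := by
    have h1 : (#(univ.biUnion bad) : ℝ) < #good := by
      calc (#(univ.biUnion bad) : ℝ) ≤ ∑ q, (#(bad q) : ℝ) := by
            exact_mod_cast Finset.card_biUnion_le
        _ ≤ ∑ _q : Bool × {s : U // s ≠ p}, ε * N := Finset.sum_le_sum fun q _ => hbad q
        _ = 2 * Fintype.card {s : U // s ≠ p} * (ε * N) := by
            rw [Finset.sum_const, Finset.card_univ, Fintype.card_prod, nsmul_eq_mul]
            simp
        _ ≤ 2 * Fintype.card U * (ε * N) := by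
            gcongr
            exact Fintype.card_subtype_le _
        _ = 2 * Fintype.card U * ε * N := by ring
        _ < κ * N := by gcongr
        _ ≤ _ := hgood
    exact_mod_cast h1
  obtain ⟨ψ, hψ, hψ'⟩ := Finset.exists_mem_notMem_of_card_lt_card hlt
  have hψ : ∀ t : Fin (k + 1) → U, IsSharedClique G u v fun i => ψ (i, t i) := by
    simpa [good] using hψ
  have hψ' : ∀ b s, s ≠ p → ¬ F.IsObstructed W (place C p (w b) ψ) s := by
    intro b s hs h
    refine hψ' (Finset.mem_biUnion.2 ⟨(b, ⟨s, hs⟩), mem_univ _, ?_⟩)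
    simpa [bad] using h
  have hfac := fun b => F.hasCompatibleFactor_range_of_not_isObstructed H (place C p (w b) ψ) W p
    (place_adj C p hp u v ψ hψ (w b) (by cases b <;> simp [w])) (hψ' b)
  refine ⟨(univ.erase p).image fun s => ψ (C s, s), ?_, ?_, ?_⟩
  · rw [Finset.disjoint_left]
    intro x hx hxW
    obtain ⟨s, hs, rfl⟩ := Finset.mem_image.1 hx
    have hsp := Finset.ne_of_mem_erase hs
    refine hψ' true s hsp (Or.inl ?_)
    unfold place
    rwa [Function.update_of_ne hsp]
  · have h1 := Finset.card_image_le (s := univ.erase p) (f := fun s => ψ (C s, s))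
    rw [Finset.card_erase_of_mem (mem_univ p), Finset.card_univ] at h1
    have : 0 < Fintype.card U := Fintype.card_pos_iff.2 ⟨p⟩
    omega
  -- The two placements agree off p, so the same S serves both.
  · have hrange : ∀ b, Set.range (place C p (w b) ψ) =
        (((univ.erase p).image fun s => ψ (C s, s) : Finset V) : Set V) ∪ {w b} := by
      intro b
      ext x
      simp only [Set.mem_range, coe_image, coe_erase, coe_univ, Set.union_singleton,
        Set.mem_insert_iff, Set.mem_image, Set.mem_sdiff, Set.mem_univ, true_and,
        Set.mem_singleton_iff]
      unfold place
      constructor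
      · rintro ⟨s, rfl⟩
        by_cases hs : s = p
        · subst hs; simp
        · exact Or.inr ⟨s, hs, by rw [Function.update_of_ne hs]⟩
      · rintro (rfl | ⟨s, hs, rfl⟩)
        · exact ⟨p, Function.update_self _ _ _⟩
        · exact ⟨s, Function.update_of_ne hs _ _⟩
    have hu := (hfac true).2
    have hv := (hfac false).2
    rw [hrange] at hu hv
    exact ⟨hu, hv⟩

end IncompatibilitySystem

/-! ### Choice of constants and conclusion -/

/-- Colours are permuted so that p gets colour 0, the one part whose vertices need not be adjacent
to u and v. -/
theorem exists_coloring_eq_zero {U : Type*} {H : SimpleGraph U} {k : ℕ}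
    (hH : H.chromaticNumber = ((k + 1 : ℕ) : ℕ∞)) :
    ∃ (C : H.Coloring (Fin (k + 1))) (p : U), C p = 0 := by
  have hU : Nonempty U := by
    by_contra hU
    rw [not_nonempty_iff] at hU
    rw [SimpleGraph.chromaticNumber_eq_zero_of_isEmpty] at hH
    exact absurd hH.symm (by exact_mod_cast Nat.succ_ne_zero k)
  obtain ⟨C⟩ := SimpleGraph.chromaticNumber_le_iff_colorable.1 hH.le
  obtain ⟨p⟩ := hU
  refine ⟨SimpleGraph.Coloring.mk (fun a => Equiv.swap (C p) 0 (C a)) ?_, p, ?_⟩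
  · intro a b hab h
    exact C.valid hab ((Equiv.swap (C p) 0).injective h)
  · exact Equiv.swap_apply_left _ _

theorem le_card_common_neighbors_of_minDegree {V : Type*} [Fintype V] [Nonempty V]
    (G : SimpleGraph V) [DecidableRel G.Adj] {k : ℕ} (hk : 1 ≤ k) {α : ℝ} (hα : 0 < α)
    (h : (1 - 1 / (k : ℝ) + α) * Fintype.card V ≤ (G.minDegree : ℝ)) (T : Finset V)
    (hT : #T ≤ k) : α * Fintype.card V ≤ #{w | ∀ t ∈ T, G.Adj t w} := by
  refine le_trans ?_ (le_card_common_neighbors G _ h T)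
  have hk' : (1 : ℝ) ≤ k := by exact_mod_cast hk
  have hT' : (#T : ℝ) ≤ k := by exact_mod_cast hT
  have h1 : (G.minDegree : ℝ) ≤ Fintype.card V := by exact_mod_cast G.minDegree_lt_card.le
  have h2 : (#T : ℝ) * (Fintype.card V - (1 - 1 / (k : ℝ) + α) * Fintype.card V) ≤
      k * (Fintype.card V - (1 - 1 / (k : ℝ) + α) * Fintype.card V) := by
    gcongr
    linarith
  -- At most n - kαn vertices miss some element of T; the term 1/k in the degree bound is exactly
  -- what k union-bound losses cost.
  have h3 : (k : ℝ) * (Fintype.card V - (1 - 1 / (k : ℝ) + α) * Fintype.card V) =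
      Fintype.card V - k * (α * Fintype.card V) := by
    field_simp
    ring
  have h4 : α * Fintype.card V ≤ k * (α * Fintype.card V) :=
    le_mul_of_one_le_left (by positivity) hk'
  linarith

open Classical in
theorem le_card_sharedClique_of_minDegree {V : Type*} [Fintype V] [Nonempty V]
    (G : SimpleGraph V) [DecidableRel G.Adj] {k : ℕ} (hk : 1 ≤ k) {α c : ℝ} (hα : 0 < α)
    (hc : c = α ^ (k + 2) / 2)
    (h : (1 - 1 / (k : ℝ) + α) * Fintype.card V ≤ (G.minDegree : ℝ)) (u : V) :
    c * Fintype.card V ≤ #{v | c * (Fintype.card V : ℝ) ^ (k + 1) ≤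
      (#{y : Fin (k + 1) → V | IsSharedClique G u v y} : ℝ)} := by
  have hpos : (0 : ℝ) < Fintype.card V := by exact_mod_cast Fintype.card_pos
  have hsum := pow_le_sum_card_sharedClique G k (α * Fintype.card V) (by positivity) (fun T hT => by
    have h1 := le_card_common_neighbors_of_minDegree G hk hα h T hT
    convert h1) u
  refine le_card_filter_of_le_sum
    (fun v => (#{y : Fin (k + 1) → V | IsSharedClique G u v y} : ℝ)) _ c
    (by positivity) (fun v => ?_) (by rw [hc]; positivity) ?_
  · have := Finset.card_le_univ ({y : Fin (k + 1) → V | IsSharedClique G u v y} : Finset _)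
    rw [Fintype.card_fun, Fintype.card_fin] at this
    exact_mod_cast this
  · refine le_trans (le_of_eq ?_) hsum
    rw [hc]
    ring

open Classical in
theorem IncompatibilitySystem.isReachable_of_card_sharedClique {U V : Type*} [Fintype U] [Fintype V]
    {G : SimpleGraph V} (F : IncompatibilitySystem G) {H : SimpleGraph U} {k : ℕ}
    (C : H.Coloring (Fin (k + 1))) (p : U) (hp : C p = 0) {c ε : ℝ} (hc : 0 ≤ c) (hε : 0 < ε)
    (hεc : 2 * Fintype.card U * ε < c ^ (Fintype.card U ^ (k + 1)))
    (hF : F.IsBounded (ε / (3 * (Fintype.card U : ℝ) ^ 2) * Fintype.card V))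
    (hn : Fintype.card U ≤ ε / 3 * Fintype.card V) (u v : V)
    (hcount : c * (Fintype.card V : ℝ) ^ (k + 1) ≤
      (#{y : Fin (k + 1) → V | IsSharedClique G u v y} : ℝ)) :
    F.IsReachable H (ε / 3 * Fintype.card V) 1 u v := by
  intro W hW
  have hV : Nonempty V := ⟨u⟩
  have hU : (0 : ℝ) < Fintype.card U := by exact_mod_cast Fintype.card_pos_iff.2 ⟨p⟩
  have hblow := blowup_count (U := U) (k + 1) (IsSharedClique G u v) c hc hcount
  -- Each of |W|, |U| and |U|^2 Δ is allotted a third of ε n.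
  obtain ⟨S, hSW, hS, hconn⟩ := F.exists_connector C p hp u v W (by positivity) hF _ ε (by
    have : (Fintype.card U : ℝ) ^ 2 * (ε / (3 * (Fintype.card U : ℝ) ^ 2) * Fintype.card V) =
        ε / 3 * Fintype.card V := by field_simp
    rw [this]
    linarith) hεc hblow
  exact ⟨S, hSW, by rwa [mul_one], hconn⟩

theorem lemma4p5 {U : Type*} [Fintype U] (H : SimpleGraph U) (r : ℕ) (hr : 2 ≤ r)
    (hH : H.chromaticNumber = (r : ℕ∞)) (α : ℝ) (hα : 0 < α) :
    ∃ μ β₁ γ₁ : ℝ, 0 < μ ∧ 0 < β₁ ∧ 0 < γ₁ ∧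
      ∃ n₀ : ℕ, ∀ n : ℕ, n₀ ≤ n →
        ∀ (V : Type*) [Fintype V] (G : SimpleGraph V) [DecidableRel G.Adj]
          (F : IncompatibilitySystem G),
          F.IsSystem n (1 - 1 / ((r : ℝ) - 1) + α) μ →
            ∀ u : V, γ₁ * n ≤ ({v : V | v ≠ u ∧ F.IsReachable H (β₁ * n) 1 u v}.ncard : ℝ) := by
  classical
  obtain ⟨k, rfl⟩ : ∃ k, r = k + 1 := ⟨r - 1, by omega⟩
  have hk : 1 ≤ k := by omega
  obtain ⟨C, p, hp⟩ := exists_coloring_eq_zero hH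
  have hU : (0 : ℝ) < Fintype.card U := by exact_mod_cast Fintype.card_pos_iff.2 ⟨p⟩
  obtain ⟨c, hc⟩ : ∃ c : ℝ, c = α ^ (k + 2) / 2 := ⟨_, rfl⟩
  have hcpos : 0 < c := by rw [hc]; positivity
  obtain ⟨ε, hεpos, hεc⟩ : ∃ ε : ℝ, 0 < ε ∧
      2 * Fintype.card U * ε < c ^ (Fintype.card U ^ (k + 1)) := by
    obtain ⟨κ, hκ⟩ : ∃ κ : ℝ, κ = c ^ (Fintype.card U ^ (k + 1)) := ⟨_, rfl⟩
    have hκpos : 0 < κ := by rw [hκ]; positivity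
    refine ⟨κ / (4 * Fintype.card U), by positivity, ?_⟩
    rw [← hκ, show 2 * (Fintype.card U : ℝ) * (κ / (4 * Fintype.card U)) = κ / 2 by
      field_simp; norm_num]
    linarith
  -- The first term of n₀ ensures |U| ≤ ε n / 3; the second ensures c n / 2 ≥ 1, so that discarding
  -- u from c n vertices leaves at least c n / 2.
  refine ⟨ε / (3 * (Fintype.card U : ℝ) ^ 2), ε / 3, c / 2, by positivity, by positivity,
    by positivity, ⌈3 * Fintype.card U / ε⌉₊ + ⌈2 / c⌉₊, ?_⟩
  intro n hn V _ G _ F hF u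
  have hV : Nonempty V := ⟨u⟩
  obtain rfl := hF.card_eq
  have hn1 : (Fintype.card U : ℝ) ≤ ε / 3 * Fintype.card V := by
    have h1 : 3 * Fintype.card U / ε ≤ Fintype.card V := (Nat.le_ceil _).trans (by
      exact_mod_cast (Nat.le_add_right _ _).trans hn)
    rw [div_le_iff₀ hεpos] at h1
    linarith
  have hn2 : 1 ≤ c / 2 * Fintype.card V := by
    have h1 : 2 / c ≤ Fintype.card V := (Nat.le_ceil _).trans (by
      exact_mod_cast (Nat.le_add_left _ _).trans hn)
    rw [div_le_iff₀ hcpos] at h1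
    linarith
  have hdeg : (1 - 1 / (k : ℝ) + α) * Fintype.card V ≤ (G.minDegree : ℝ) := by
    have := hF.le_minDegree
    rwa [Nat.cast_add, Nat.cast_one, add_sub_cancel_right] at this
  have hmany := le_card_sharedClique_of_minDegree G hk hα hc hdeg u
  set A : Finset V := {v | c * (Fintype.card V : ℝ) ^ (k + 1) ≤
    (#{y : Fin (k + 1) → V | IsSharedClique G u v y} : ℝ)} with hA
  have hsub : ((A.erase u : Finset V) : Set V) ⊆
      {v : V | v ≠ u ∧ F.IsReachable H (ε / 3 * Fintype.card V) 1 u v} := by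
    intro v hv
    have hv : v ∈ A.erase u := hv
    have hvA := Finset.mem_of_mem_erase hv
    rw [hA, Finset.mem_filter] at hvA
    exact ⟨Finset.ne_of_mem_erase hv, F.isReachable_of_card_sharedClique C p hp hcpos.le hεpos hεc
      hF.bounded hn1 u v hvA.2⟩
  have hcard := Set.ncard_le_ncard hsub (Set.toFinite _)
  rw [Set.ncard_coe_finset] at hcard
  have hcard' : (#A : ℝ) ≤
      ({v : V | v ≠ u ∧ F.IsReachable H (ε / 3 * Fintype.card V) 1 u v}.ncard : ℝ) + 1 := by
    have : #A ≤ #(A.erase u) + 1 := Nat.sub_le_iff_le_add.1 Finset.pred_card_le_card_erase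
    exact_mod_cast this.trans (Nat.add_le_add_right hcard 1)
  linarith
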